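/- **Setting.** There are $K$ agents and $N$ items with unknown qualities $\mu\in\mathbb R^N$. Agent $j$ has a family $\mathcal A_j\subseteq 2^{\{1,\dots,N\}}$ of feasible bundles with $\emptyset\in\mathcal A_j$, and a reward function $r^j(x;S)$, $x\in\mathbb R^N$, $S\in\bigcup_k\mathcal A_k$. The set $\mathcal M$ of allocations is either the set of all $\phi$ with $\phi(j)\in\mathcal A_j$ for all $j$ and $\phi(i)\cap\phi(j)=\emptyset$ for $i\ne j$, or (general regime) the set of all $\phi$ with $\phi(j)\in\bigcup_k\mathcal A_k$ for all $j$ and $\phi(i)\neq\phi(j)$ for $i\ne j$. Put $$ev_{i\to j}(x,y,\phi)=\max\{r^i(x;\phi(j))-r^i(y;\phi(i)),0\},\qquad ev_{i\to j}(\mu,\phi)=ev_{i\to j}(\mu,\mu,\phi),\qquad ev(\mu,\phi)=\max_{i,j}ev_{i\to j}(\mu,\phi),$$ and let $\phi^*\in\arg\min_{\phi\in\mathcal M}ev(\mu,\phi)$. At each round $t\ge1$ a pulled item $i$ shows the signal $X_i(t)=\mu_i+\epsilon_i(t)$; the noise vectors $\epsilon(t)\in\mathbb R^N$ are i.i.d.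 over $t$ and each $\epsilon_i(t)$ is $\sigma^2$-sub-Gaussian, that is, $\mathbb E\,e^{\lambda\epsilon_i(t)}\le e^{\sigma^2\lambda^2/2}$ for all $\lambda\in\mathbb R$. **Envy-combinatorial ULCB algorithm** (parameters $\sigma>0$, $\alpha>2$). In round $t=1,\dots,N$ pull item $t$ (the allocation $\phi_t\in\mathcal M$ handed out in these rounds is arbitrary). In round $t>N$, let $T_i(t-1)$ be the number of pulls of item $i$ in rounds $1,\dots,t-1$, let $\hat\mu_i$ be the mean of the signals collected for item $i$ in these rounds, and let $$\bar\nu_i(t)=\hat\mu_i+\sqrt{\tfrac{2\sigma^2\log t^\alpha}{T_i(t-1)}},\qquad \underline\nu_i(t)=\hat\mu_i-\sqrt{\tfrac{2\sigma^2\log t^\alpha}{T_i(t-1)}}.$$ An oracle returns some $\phi_t\in\arg\min_{\phi\in\mathcal M}\max_{i,j}ev_{i\to j}(\underline\nu(t),\bar\nu(t),\phi)$, a second oracle returns some $(i_t,j_t)\in\arg\max_{i,j}ev_{i\to j}(\bar\nu(t),\underline\nu(t),\phi_t)$ (ties are broken by any fixed measurable rule), and all items of $\phi_t(i_t)\cup\phi_t(j_t)$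 are pulled. The regret is $R_T=\mathbb E\big[\sum_{t=1}^T\big(ev(\mu,\phi_t)-ev(\mu,\phi^*)\big)\big]$. **Proposition.** For all $\alpha>2$, $\sigma>0$, $c>0$ and $\Delta_{e,\max}>0$ there is a constant $C>0$, depending on these four numbers only, such that the following holds for all $N$, $K$, all $T>N$ and all instances as above. Assume 1. (Lipschitz-monotone rewards) for every agent $j$, every $S\in\bigcup_k\mathcal A_k$ and all $x,y\in\mathbb R^N$, $|r^j(x;S)-r^j(y;S)|\le c\sum_{i\in S}|x_i-y_i|$, and $r^j(x;S)\le r^j(y;S)$ whenever $x_i\le y_i$ for all $i\in S$; 2. (bounded envy range) for all $\phi_1,\phi_2\in\mathcal M$ and all ordered pairs of agents $(i,j)\ne(i',j')$, $|ev_{i\to j}(\mu,\phi_1)-ev_{i'\to j'}(\mu,\phi_2)|\le\Delta_{e,\max}$. Then the random regret is integrable and $R_T\le C\,N\,T^{2/3}(\log T)^{1/2}$. No gap between the envy of optimal and of non-optimal allocations is assumed. -/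

import Mathlib

open MeasureTheory ProbabilityTheory

noncomputable section

namespace EnvyBandit

/-- An assignment of a bundle (a set of items in `Fin N`) to each agent in `Fin K`. -/
abbrev Assignment (N K : ℕ) := Fin K → Finset (Fin N)

/-- Allocations: each agent gets one of its feasible bundles, distinct agents get disjoint
bundles. -/
def disjointAllocations {N K : ℕ} (A : Fin K → Set (Finset (Fin N))) : Set (Assignment N K) :=
  {φ | (∀ j, φ j ∈ A j) ∧ ∀ i j, i ≠ j → Disjoint (φ i) (φ j)}

/-- The regime without capacities: bundles come from the union of the feasible families and
distinct agents get distinct, possibly overlapping, bundles. -/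
def distinctAllocations {N K : ℕ} (A : Fin K → Set (Finset (Fin N))) : Set (Assignment N K) :=
  {φ | (∀ j, φ j ∈ ⋃ k, A k) ∧ ∀ i j, i ≠ j → φ i ≠ φ j}

/-- Lipschitz and monotone rewards: `r j x S` is the reward of agent `j` for the bundle `S` when
the item qualities are `x`. Envy evaluates the reward function of one agent at the bundle of
another one, so `S` runs over the union of the feasible families. -/
def LipschitzMonotone {N K : ℕ} (c : ℝ) (A : Fin K → Set (Finset (Fin N)))
    (r : Fin K → (Fin N → ℝ) → Finset (Fin N) → ℝ) : Prop :=
  ∀ j, ∀ S ∈ ⋃ k, A k,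
    (∀ x y : Fin N → ℝ, |r j x S - r j y S| ≤ c * ∑ i ∈ S, |x i - y i|) ∧
    (∀ x y : Fin N → ℝ, (∀ i ∈ S, x i ≤ y i) → r j x S ≤ r j y S)

/-- The two-argument envy `ev_{i → j}(x, y, φ) = (r^i(x; φ(j)) - r^i(y; φ(i)))⁺`. -/
def pairEnvy {N K : ℕ} (r : Fin K → (Fin N → ℝ) → Finset (Fin N) → ℝ)
    (x y : Fin N → ℝ) (φ : Assignment N K) (i j : Fin K) : ℝ :=
  max (r i x (φ j) - r i y (φ i)) 0

/-- The maximum of `ev_{i → j}(x, y, φ)` over all pairs of agents. -/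
def maxEnvy {N K : ℕ} (r : Fin K → (Fin N → ℝ) → Finset (Fin N) → ℝ)
    (x y : Fin N → ℝ) (φ : Assignment N K) : ℝ :=
  ⨆ p : Fin K × Fin K, pairEnvy r x y φ p.1 p.2

/-- The envy `ev(μ, φ)` of an allocation at the quality vector `μ`. -/
def envy {N K : ℕ} (r : Fin K → (Fin N → ℝ) → Finset (Fin N) → ℝ)
    (μ : Fin N → ℝ) (φ : Assignment N K) : ℝ :=
  maxEnvy r μ μ φ

/-- The set of allocations in `M` of minimal envy at `μ`. -/
def minEnvySet {N K : ℕ} (M : Set (Assignment N K))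
    (r : Fin K → (Fin N → ℝ) → Finset (Fin N) → ℝ) (μ : Fin N → ℝ) : Set (Assignment N K) :=
  {φ | φ ∈ M ∧ ∀ ψ ∈ M, envy r μ φ ≤ envy r μ ψ}

/-- Bounded envy range: pairwise envies for two different ordered pairs of agents, in any two
allocations, differ by at most `D`. -/
def BoundedEnvyRange {N K : ℕ} (D : ℝ) (M : Set (Assignment N K))
    (r : Fin K → (Fin N → ℝ) → Finset (Fin N) → ℝ) (μ : Fin N → ℝ) : Prop :=
  ∀ φ₁ ∈ M, ∀ φ₂ ∈ M, ∀ i j i' j' : Fin K, (i, j) ≠ (i', j') →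
    |pairEnvy r μ μ φ₁ i j - pairEnvy r μ μ φ₂ i' j'| ≤ D

/-- First oracle: a (measurable) selection of `argmin_{φ ∈ M} max_{i,j} ev_{i → j}(x, y, φ)`. -/
def IsAllocationOracle {N K : ℕ} (M : Set (Assignment N K))
    (r : Fin K → (Fin N → ℝ) → Finset (Fin N) → ℝ)
    (O₁ : (Fin N → ℝ) → (Fin N → ℝ) → Assignment N K) : Prop :=
  (∀ x y, O₁ x y ∈ M ∧ ∀ φ ∈ M, maxEnvy r x y (O₁ x y) ≤ maxEnvy r x y φ) ∧
  ∀ φ, MeasurableSet {p : (Fin N → ℝ) × (Fin N → ℝ) | O₁ p.1 p.2 = φ}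

/-- Second oracle: a (measurable) selection of `argmax_{i,j} ev_{i → j}(x, y, φ)`. -/
def IsPairOracle {N K : ℕ} (M : Set (Assignment N K))
    (r : Fin K → (Fin N → ℝ) → Finset (Fin N) → ℝ)
    (O₂ : (Fin N → ℝ) → (Fin N → ℝ) → Assignment N K → Fin K × Fin K) : Prop :=
  (∀ x y, ∀ φ ∈ M, ∀ i j,
    pairEnvy r x y φ i j ≤ pairEnvy r x y φ (O₂ x y φ).1 (O₂ x y φ).2) ∧
  ∀ φ ∈ M, ∀ q, MeasurableSet {p : (Fin N → ℝ) × (Fin N → ℝ) | O₂ p.1 p.2 φ = q}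

/-- What the learner knows after some rounds: for each item, how often it has been pulled and the
sum of the signals collected for it. -/
structure Stats (N : ℕ) where
  count : Fin N → ℕ
  total : Fin N → ℝ

/-- Empirical mean of the collected signals of item `i`. -/
def Stats.mean {N : ℕ} (s : Stats N) (i : Fin N) : ℝ := s.total i / (s.count i : ℝ)

/-- Confidence radius at round `t`, from the statistics of the previous rounds. -/
def Stats.radius {N : ℕ} (s : Stats N) (α σ : ℝ) (t : ℕ) (i : Fin N) : ℝ :=
  Real.sqrt (1 / (s.count i : ℝ) * (2 * σ ^ 2 * Real.log ((t : ℝ) ^ α)))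

/-- The UCB vector at round `t`. -/
def Stats.ucb {N : ℕ} (s : Stats N) (α σ : ℝ) (t : ℕ) : Fin N → ℝ :=
  fun i => s.mean i + s.radius α σ t i

/-- The LCB vector at round `t`. -/
def Stats.lcb {N : ℕ} (s : Stats N) (α σ : ℝ) (t : ℕ) : Fin N → ℝ :=
  fun i => s.mean i - s.radius α σ t i

/-- Record the signals `x i` of the items `i` in the pulled set `I`. -/
def Stats.update {N : ℕ} (s : Stats N) (I : Finset (Fin N)) (x : Fin N → ℝ) : Stats N where
  count := fun i => if i ∈ I then s.count i + 1 else s.count i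
  total := fun i => if i ∈ I then s.total i + x i else s.total i

/-- Input of the Envy-combinatorial ULCB algorithm: the parameters `α, σ`, the two oracles, and the
allocations `init t` that are handed out in the initial rounds `t = 1, …, N`, about which the
algorithm says nothing. -/
structure Algorithm (N K : ℕ) where
  α : ℝ
  σ : ℝ
  O₁ : (Fin N → ℝ) → (Fin N → ℝ) → Assignment N K
  O₂ : (Fin N → ℝ) → (Fin N → ℝ) → Assignment N K → Fin K × Fin K
  init : ℕ → Assignment N K

/-- The allocation `φ_t` chosen at round `t`, given the statistics of the previous rounds. -/
def Algorithm.choose {N K : ℕ} (a : Algorithm N K) (t : ℕ) (s : Stats N) : Assignment N K :=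
  if t ≤ N then a.init t else a.O₁ (s.lcb a.α a.σ t) (s.ucb a.α a.σ t)

/-- The set of items pulled at round `t`: the `t`-th item in the initial rounds `t = 1, …, N`, and
afterwards the items of `φ_t(i_t) ∪ φ_t(j_t)`, where `(i_t, j_t)` is the pair that the second oracle
returns. -/
def Algorithm.pull {N K : ℕ} (a : Algorithm N K) (t : ℕ) (s : Stats N) : Finset (Fin N) :=
  if t ≤ N then Finset.univ.filter (fun i : Fin N => (i : ℕ) + 1 = t)
  else
    let φ := a.choose t s
    let q := a.O₂ (s.ucb a.α a.σ t) (s.lcb a.α a.σ t) φ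
    φ q.1 ∪ φ q.2

/-- The statistics after the rounds `1, …, t` when `X s i` is the signal of item `i` at
round `s`. -/
def Algorithm.stats {N K : ℕ} (a : Algorithm N K) (X : ℕ → Fin N → ℝ) : ℕ → Stats N
  | 0 => ⟨fun _ => 0, fun _ => 0⟩
  | t + 1 => (a.stats X t).update (a.pull (t + 1) (a.stats X t)) (X (t + 1))

/-- The allocation `φ_t` of round `t ≥ 1` along the signals `X`. -/
def Algorithm.alloc {N K : ℕ} (a : Algorithm N K) (X : ℕ → Fin N → ℝ) (t : ℕ) : Assignment N K :=
  a.choose t (a.stats X (t - 1))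

/-- The random regret `∑_{t=1}^T (ev(μ, φ_t) - ev(μ, φ*))` along the signals `X`. -/
def Algorithm.pathRegret {N K : ℕ} (a : Algorithm N K)
    (r : Fin K → (Fin N → ℝ) → Finset (Fin N) → ℝ) (μ : Fin N → ℝ) (φstar : Assignment N K)
    (X : ℕ → Fin N → ℝ) (T : ℕ) : ℝ :=
  ∑ t ∈ Finset.Icc 1 T, (envy r μ (a.alloc X t) - envy r μ φstar)

/-- The noise vectors `ε t` are independent and identically distributed over the rounds `t`, with
`σ²`-sub-Gaussian (hence centred) coordinates. -/
structure IsNoise {N : ℕ} {Ω : Type*} [MeasurableSpace Ω] (P : Measure Ω) (σ : ℝ)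
    (ε : ℕ → Ω → Fin N → ℝ) : Prop where
  measurable : ∀ t, Measurable (ε t)
  indep : iIndepFun ε P
  identDistrib : ∀ s t, IdentDistrib (ε s) (ε t) P P
  subgaussian : ∀ t i, HasSubgaussianMGF (fun ω => ε t ω i) (σ ^ 2).toNNReal P

end EnvyBandit

end

/-! The proof is optimism plus a pathwise count of pulls. Suppose that all means lie in their
confidence intervals. Envy increases in its first argument and decreases in its second, so `(lcb,
ucb)` underestimates the true envy and `(ucb, lcb)` overestimates it. The chosen allocation has
least underestimate, hence its regret is at most the gap between its two estimates at the most
envious pair. By the Lipschitz condition this gap is controlled by the radii of the items of that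
pair (`envy_sub_envy_le`), and these are exactly the items pulled. Each pull thus pays for its own
regret, of order `1 / √count`; per item this sums to order `√T` (`sum_inv_sqrt_count_le`), so no gap
assumption enters.

Initial rounds and rounds with a failed interval cost at most `D` each. Pulls are adaptive, so
failures are bounded through an exponential supermartingale (`lintegral_expNoise_le`), Markov's
inequality and a union over the number of pulls; the probabilities are summable because `α > 2`. The
resulting order `N √(T log T)` is below the claimed rate. -/

namespace EnvyBandit

/-! ### Deterministic envy estimates -/

section Envy

variable {N K : ℕ} {r : Fin K → (Fin N → ℝ) → Finset (Fin N) → ℝ}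
  {A : Fin K → Set (Finset (Fin N))} {M : Set (Assignment N K)} {c D : ℝ}

theorem pairEnvy_le_maxEnvy (x y : Fin N → ℝ) (φ : Assignment N K) (i j : Fin K) :
    pairEnvy r x y φ i j ≤ maxEnvy r x y φ :=
  le_ciSup (f := fun p : Fin K × Fin K => pairEnvy r x y φ p.1 p.2)
    (Set.finite_range _).bddAbove (i, j)

theorem maxEnvy_nonneg (x y : Fin N → ℝ) (φ : Assignment N K) : 0 ≤ maxEnvy r x y φ :=
  Real.iSup_nonneg fun _ => le_max_right _ _

/-- The hypothesis `hb` covers `K = 0`, where the supremum over no pairs is `0`. -/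
theorem maxEnvy_le {x y : Fin N → ℝ} {φ : Assignment N K} {b : ℝ} (hb : 0 ≤ b)
    (h : ∀ i j, pairEnvy r x y φ i j ≤ b) : maxEnvy r x y φ ≤ b :=
  Real.iSup_le (fun p => h p.1 p.2) hb

theorem mem_iUnion_of_mem_allocations
    (hM : M = disjointAllocations A ∨ M = distinctAllocations A) {φ : Assignment N K}
    (hφ : φ ∈ M) (j : Fin K) : φ j ∈ ⋃ k, A k := by
  rcases hM with rfl | rfl
  · exact Set.mem_iUnion.2 ⟨j, hφ.1 j⟩
  · exact hφ.1 j

theorem pairEnvy_mono (hr : LipschitzMonotone c A r) {φ : Assignment N K}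
    (hφ : ∀ j, φ j ∈ ⋃ k, A k) {x x' y y' : Fin N → ℝ} (hx : ∀ i, x i ≤ x' i)
    (hy : ∀ i, y' i ≤ y i) (i j : Fin K) :
    pairEnvy r x y φ i j ≤ pairEnvy r x' y' φ i j :=
  max_le_max (sub_le_sub ((hr i _ (hφ j)).2 x x' fun k _ => hx k)
    ((hr i _ (hφ i)).2 y' y fun k _ => hy k)) le_rfl

/-- Exchanging the two arguments changes the pairwise envy by a Lipschitz amount. -/
theorem pairEnvy_sub_swap_le (hc : 0 ≤ c) (hr : LipschitzMonotone c A r) {φ : Assignment N K}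
    (hφ : ∀ j, φ j ∈ ⋃ k, A k) (x y : Fin N → ℝ) (i j : Fin K) :
    pairEnvy r y x φ i j - pairEnvy r x y φ i j ≤ 2 * c * ∑ k ∈ φ i ∪ φ j, |y k - x k| := by
  -- One Lipschitz estimate per bundle, each enlarged to the union since the bundles may overlap:
  -- hence the factor `2`.
  have h1 := (abs_le.1 ((hr i _ (hφ j)).1 y x)).2
  have h2 := (abs_le.1 ((hr i _ (hφ i)).1 y x)).2
  have h3 : ∑ k ∈ φ j, |y k - x k| ≤ ∑ k ∈ φ i ∪ φ j, |y k - x k| :=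
    Finset.sum_le_sum_of_subset_of_nonneg Finset.subset_union_right fun _ _ _ => abs_nonneg _
  have h4 : ∑ k ∈ φ i, |y k - x k| ≤ ∑ k ∈ φ i ∪ φ j, |y k - x k| :=
    Finset.sum_le_sum_of_subset_of_nonneg Finset.subset_union_left fun _ _ _ => abs_nonneg _
  have h5 := mul_le_mul_of_nonneg_left h3 hc
  have h6 := mul_le_mul_of_nonneg_left h4 hc
  have h7 : 0 ≤ c * ∑ k ∈ φ i ∪ φ j, |y k - x k| :=
    mul_nonneg hc (Finset.sum_nonneg fun _ _ => abs_nonneg _)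
  have h8 := le_max_left (r i x (φ j) - r i y (φ i)) 0
  have h9 := le_max_right (r i x (φ j) - r i y (φ i)) 0
  unfold pairEnvy
  rw [sub_le_iff_le_add]
  exact max_le (by linarith) (by linarith)

/-- Optimism: if `μ` lies between `x` and `y`, an allocation of least optimistic envy has excess
envy at most the width of the confidence box over the bundles of the most envious pair. -/
theorem envy_sub_envy_le (hc : 0 ≤ c) (hr : LipschitzMonotone c A r)
    (hA : ∀ φ ∈ M, ∀ j, φ j ∈ ⋃ k, A k) {μ x y : Fin N → ℝ} (hx : ∀ i, x i ≤ μ i)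
    (hy : ∀ i, μ i ≤ y i) {φ ψ : Assignment N K} (hφ : φ ∈ M) (hψ : ψ ∈ M)
    (hmin : maxEnvy r x y φ ≤ maxEnvy r x y ψ) {q : Fin K × Fin K}
    (hq : ∀ i j, pairEnvy r y x φ i j ≤ pairEnvy r y x φ q.1 q.2) :
    envy r μ φ - envy r μ ψ ≤ 2 * c * ∑ k ∈ φ q.1 ∪ φ q.2, |y k - x k| := by
  have h1 : envy r μ φ ≤ pairEnvy r y x φ q.1 q.2 :=
    maxEnvy_le (le_max_right _ _) fun i j =>
      (pairEnvy_mono hr (hA φ hφ) hy hx i j).trans (hq i j)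
  have h2 : maxEnvy r x y ψ ≤ envy r μ ψ :=
    maxEnvy_le (maxEnvy_nonneg _ _ _) fun i j =>
      (pairEnvy_mono hr (hA ψ hψ) hx hy i j).trans (pairEnvy_le_maxEnvy _ _ _ i j)
  -- Only the pair `q` is compared under both orders of the arguments, so only the widths on its two
  -- bundles enter.
  have h3 := pairEnvy_le_maxEnvy (r := r) x y φ q.1 q.2
  have h4 := pairEnvy_sub_swap_le hc hr (hA φ hφ) x y q.1 q.2
  linarith

/-- The range hypothesis compares different pairs only, so each envy in `φ` is compared with that of
another pair in `ψ`. If there is no other pair, then `i = j` and the envy vanishes. -/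
theorem envy_sub_envy_le_range (hD : 0 ≤ D) {μ : Fin N → ℝ} (hB : BoundedEnvyRange D M r μ)
    {φ ψ : Assignment N K} (hφ : φ ∈ M) (hψ : ψ ∈ M) : envy r μ φ - envy r μ ψ ≤ D := by
  have h0 : 0 ≤ envy r μ ψ := maxEnvy_nonneg _ _ _
  rw [sub_le_iff_le_add]
  refine maxEnvy_le (by linarith) fun i j => ?_
  by_cases h : ∃ p : Fin K × Fin K, (i, j) ≠ p
  · obtain ⟨⟨i', j'⟩, hp⟩ := h
    have h1 := (abs_le.1 (hB φ hφ ψ hψ i j i' j' hp)).2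
    have h2 : pairEnvy r μ μ ψ i' j' ≤ envy r μ ψ := pairEnvy_le_maxEnvy _ _ _ i' j'
    linarith
  · push Not at h
    have hij : i = j := congrArg Prod.fst (h (j, j))
    subst hij
    simp only [pairEnvy, sub_self, max_self]
    linarith

end Envy

/-! ### Pull counts and sums of confidence radii -/

section Counting

variable {N K : ℕ}

theorem Algorithm.count_succ (a : Algorithm N K) (X : ℕ → Fin N → ℝ) (t : ℕ) (i : Fin N) :
    (a.stats X (t + 1)).count i = if i ∈ a.pull (t + 1) (a.stats X t)
      then (a.stats X t).count i + 1 else (a.stats X t).count i := rfl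

theorem Algorithm.total_succ (a : Algorithm N K) (X : ℕ → Fin N → ℝ) (t : ℕ) (i : Fin N) :
    (a.stats X (t + 1)).total i = if i ∈ a.pull (t + 1) (a.stats X t)
      then (a.stats X t).total i + X (t + 1) i else (a.stats X t).total i := rfl

theorem Algorithm.count_le (a : Algorithm N K) (X : ℕ → Fin N → ℝ) (t : ℕ) (i : Fin N) :
    (a.stats X t).count i ≤ t := by
  induction t with
  | zero => exact le_rfl
  | succ t ih => rw [a.count_succ]; split_ifs <;> omega

/-- Items are numbered from `0` and rounds from `1`, so item `i` is pulled in round `i + 1`.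
Positive counts keep the radius away from the default value of division by zero. -/
theorem Algorithm.one_le_count (a : Algorithm N K) (X : ℕ → Fin N → ℝ) {t : ℕ} {i : Fin N}
    (h : (i : ℕ) < t) : 1 ≤ (a.stats X t).count i := by
  induction t with
  | zero => omega
  | succ t ih =>
    rw [a.count_succ]
    rcases Nat.lt_succ_iff_lt_or_eq.1 h with h | h
    · have := ih h
      split_ifs <;> omega
    · have : i ∈ a.pull (t + 1) (a.stats X t) := by
        have := i.2
        rw [Algorithm.pull, if_pos (by omega)]
        simp [h]
      rw [if_pos this]; omega

/-- With `u = √k` and `v = √(k + 1)`, one has `(v - u) * (v + u) = 1` and, as `k ≥ 1`, `v ≤ 2 * u`;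
hence `1 ≤ 3 * u * (v - u)`. -/
theorem inv_sqrt_add_le {k : ℕ} (hk : 1 ≤ k) :
    3 * √(k : ℝ) + 1 / √(k : ℝ) ≤ 3 * √((k + 1 : ℕ) : ℝ) := by
  have hk' : (1 : ℝ) ≤ k := by exact_mod_cast hk
  set u := √(k : ℝ) with hu
  set v := √((k + 1 : ℕ) : ℝ) with hv
  have hu0 : 0 < u := Real.sqrt_pos.2 (by linarith)
  have hu2 : u ^ 2 = k := Real.sq_sqrt (by linarith)
  have hv0 : 0 ≤ v := Real.sqrt_nonneg _
  have hv2 : v ^ 2 = k + 1 := by rw [hv, Real.sq_sqrt (by positivity)]; push_cast; ring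
  have hvu : v ≤ 2 * u := abs_le_of_sq_le_sq' (by nlinarith) (by linarith) |>.2
  have hle : u ≤ v := abs_le_of_sq_le_sq' (by nlinarith) hv0 |>.2
  have h1 : 1 / u ≤ 3 * (v - u) := by
    rw [div_le_iff₀ hu0]
    nlinarith
  linarith

/-- The inverse square roots of the counts, summed over the pulls of an item. -/
theorem Algorithm.sum_inv_sqrt_count_le (a : Algorithm N K) (X : ℕ → Fin N → ℝ) (i : Fin N)
    {n : ℕ} (hn : N ≤ n) :
    ∑ t ∈ Finset.Ico N n, (if i ∈ a.pull (t + 1) (a.stats X t)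
      then 1 / √((a.stats X t).count i : ℝ) else 0) ≤ 3 * √((a.stats X n).count i : ℝ) := by
  induction n, hn using Nat.le_induction with
  | base => simp
  | succ n hn ih =>
    rw [Finset.sum_Ico_succ_top hn, a.count_succ]
    split_ifs with h
    · have := inv_sqrt_add_le (a.one_le_count X (i := i) (t := n) (by omega))
      linarith
    · linarith

theorem Stats.radius_eq (s : Stats N) (α σ : ℝ) {t : ℕ} (ht : 1 ≤ t) (i : Fin N) :
    s.radius α σ t i = √(2 * σ ^ 2 * α * Real.log t) * (1 / √(s.count i : ℝ)) := by
  have : (0 : ℝ) < t := by exact_mod_cast ht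
  rw [Stats.radius, Real.log_rpow this, Real.sqrt_mul (by positivity), Real.sqrt_div zero_le_one,
    Real.sqrt_one, mul_comm, mul_assoc, mul_assoc, mul_assoc]

/-- The confidence radii of all pulled items, summed over all rounds. -/
theorem Algorithm.sum_radius_le (a : Algorithm N K) (hα : 0 ≤ a.α) (X : ℕ → Fin N → ℝ) {T : ℕ}
    (hT : N ≤ T) :
    ∑ t ∈ Finset.Ico N T, ∑ i ∈ a.pull (t + 1) (a.stats X t),
        (a.stats X t).radius a.α a.σ (t + 1) i
      ≤ N * (√(2 * a.σ ^ 2 * a.α * Real.log T) * (3 * √T)) := by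
  have h1 : ∀ t ∈ Finset.Ico N T, ∑ i ∈ a.pull (t + 1) (a.stats X t),
      (a.stats X t).radius a.α a.σ (t + 1) i ≤ ∑ i, √(2 * a.σ ^ 2 * a.α * Real.log T) *
        (if i ∈ a.pull (t + 1) (a.stats X t) then 1 / √((a.stats X t).count i : ℝ) else 0) := by
    intro t ht
    rw [Finset.mem_Ico] at ht
    simp only [mul_ite, mul_zero, Finset.sum_ite_mem, Finset.univ_inter]
    refine Finset.sum_le_sum fun i _ => ?_
    rw [Stats.radius_eq _ _ _ (by omega)]
    have h2 : ((t + 1 : ℕ) : ℝ) ≤ T := by exact_mod_cast ht.2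
    gcongr
  refine (Finset.sum_le_sum h1).trans ?_
  -- Items are now summed last, and each contributes the same bound: this gives the factor `N`.
  rw [Finset.sum_comm]
  have h2 : ∀ i ∈ (Finset.univ : Finset (Fin N)), ∑ t ∈ Finset.Ico N T,
      √(2 * a.σ ^ 2 * a.α * Real.log T) *
        (if i ∈ a.pull (t + 1) (a.stats X t) then 1 / √((a.stats X t).count i : ℝ) else 0)
      ≤ √(2 * a.σ ^ 2 * a.α * Real.log T) * (3 * √T) := by
    intro i _
    rw [← Finset.mul_sum]
    refine mul_le_mul_of_nonneg_left ((a.sum_inv_sqrt_count_le X i hT).trans ?_)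
      (Real.sqrt_nonneg _)
    have : ((a.stats X T).count i : ℝ) ≤ T := by exact_mod_cast a.count_le X T i
    gcongr
  simpa using Finset.sum_le_sum h2

end Counting

/-! ### Measurability of the algorithm's decisions -/

section Measurability

variable {N K : ℕ} {r : Fin K → (Fin N → ℝ) → Finset (Fin N) → ℝ} {M : Set (Assignment N K)}
  {a : Algorithm N K} {Ω : Type*}

theorem Algorithm.choose_mem (h₁ : IsAllocationOracle M r a.O₁) (hi : ∀ t, a.init t ∈ M) (t : ℕ)
    (s : Stats N) : a.choose t s ∈ M := by
  unfold Algorithm.choose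
  split_ifs
  · exact hi t
  · exact (h₁.1 _ _).1

/-- The σ-algebra is arbitrary because both the ambient one and that of the noise up to round `t`
are needed later. -/
theorem measurable_bounds {m : MeasurableSpace Ω} {s : Ω → Stats N}
    (hc : ∀ i, Measurable fun ω => (s ω).count i) (ht : ∀ i, Measurable fun ω => (s ω).total i)
    (α σ : ℝ) (t : ℕ) :
    Measurable (fun ω => (s ω).lcb α σ t) ∧ Measurable (fun ω => (s ω).ucb α σ t) := by
  have hc' : ∀ i, Measurable fun ω => ((s ω).count i : ℝ) := fun i =>
    measurable_from_nat.comp (hc i)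
  have hm : ∀ i, Measurable fun ω => (s ω).mean i := fun i => (ht i).div (hc' i)
  have hr : ∀ i, Measurable fun ω => (s ω).radius α σ t i := fun i =>
    (((hc' i).const_div 1).mul_const _).sqrt
  exact ⟨measurable_pi_lambda _ fun i => (hm i).sub (hr i),
    measurable_pi_lambda _ fun i => (hm i).add (hr i)⟩

theorem measurableSet_choose_eq (h₁ : IsAllocationOracle M r a.O₁) {m : MeasurableSpace Ω}
    {s : Ω → Stats N} (hc : ∀ i, Measurable fun ω => (s ω).count i)
    (ht : ∀ i, Measurable fun ω => (s ω).total i) (t : ℕ) (φ : Assignment N K) :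
    MeasurableSet {ω | a.choose t (s ω) = φ} := by
  unfold Algorithm.choose
  split_ifs
  · exact MeasurableSet.const _
  · obtain ⟨hl, hu⟩ := measurable_bounds hc ht a.α a.σ t
    exact (hl.prodMk hu) (h₁.2 φ)

theorem measurableSet_mem_pull (h₁ : IsAllocationOracle M r a.O₁) (h₂ : IsPairOracle M r a.O₂)
    (hi : ∀ t, a.init t ∈ M) {m : MeasurableSpace Ω} {s : Ω → Stats N}
    (hc : ∀ i, Measurable fun ω => (s ω).count i) (ht : ∀ i, Measurable fun ω => (s ω).total i)
    (t : ℕ) (i : Fin N) : MeasurableSet {ω | i ∈ a.pull t (s ω)} := by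
  by_cases htN : t ≤ N
  · simp only [Algorithm.pull, if_pos htN]
    exact MeasurableSet.const _
  · obtain ⟨hl, hu⟩ := measurable_bounds hc ht a.α a.σ t
    -- A finite union over the oracle outputs. The condition `φ ∈ M` is kept because the second
    -- oracle is measurable only for such `φ`.
    have : {ω | i ∈ a.pull t (s ω)} = ⋃ φ : Assignment N K, ⋃ q : Fin K × Fin K,
        {ω | (φ ∈ M ∧ i ∈ φ q.1 ∪ φ q.2) ∧ a.choose t (s ω) = φ ∧
          a.O₂ ((s ω).ucb a.α a.σ t) ((s ω).lcb a.α a.σ t) φ = q} := by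
      ext ω
      simp only [Algorithm.pull, if_neg htN, Set.mem_ofPred_eq, Set.mem_iUnion]
      constructor
      · exact fun h => ⟨_, _, ⟨a.choose_mem h₁ hi t _, h⟩, rfl, rfl⟩
      · rintro ⟨φ, q, ⟨_, h⟩, rfl, rfl⟩
        exact h
    rw [this]
    refine MeasurableSet.iUnion fun φ => MeasurableSet.iUnion fun q => ?_
    by_cases hp : φ ∈ M ∧ i ∈ φ q.1 ∪ φ q.2
    · simp only [hp, true_and]
      exact (measurableSet_choose_eq h₁ hc ht t φ).inter ((hu.prodMk hl) (h₂.2 φ hp.1 q))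
    · simp only [hp, false_and]
      exact MeasurableSet.const _

/-- Only signals up to round `t` are used; for the natural filtration of the noise this is
adaptedness. -/
theorem measurable_stats (h₁ : IsAllocationOracle M r a.O₁) (h₂ : IsPairOracle M r a.O₂)
    (hi : ∀ t, a.init t ∈ M) {m : MeasurableSpace Ω} {X : ℕ → Ω → Fin N → ℝ} {t : ℕ}
    (hX : ∀ s ≤ t, Measurable (X s)) :
    (∀ i, Measurable fun ω => (a.stats (fun s => X s ω) t).count i) ∧
      ∀ i, Measurable fun ω => (a.stats (fun s => X s ω) t).total i := by
  induction t with
  | zero => exact ⟨fun i => measurable_const, fun i => measurable_const⟩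
  | succ t ih =>
    obtain ⟨hc, ht⟩ := ih fun s hs => hX s (by omega)
    have hp := fun i => measurableSet_mem_pull h₁ h₂ hi hc ht (t + 1) i
    exact ⟨fun i => Measurable.ite (hp i) ((hc i).add_const 1) (hc i),
      fun i => Measurable.ite (hp i)
        ((ht i).add ((measurable_pi_apply i).comp (hX (t + 1) le_rfl))) (ht i)⟩

end Measurability

/-! ### Concentration under adaptive pulls -/

section Concentration

variable {N K : ℕ} {r : Fin K → (Fin N → ℝ) → Finset (Fin N) → ℝ} {M : Set (Assignment N K)}
  {a : Algorithm N K} {Ω : Type*} {ε : ℕ → Ω → Fin N → ℝ} {σ : ℝ}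

/-- The statistics after `t` rounds when the noise is `ε`. -/
noncomputable def Algorithm.noisyStats (a : Algorithm N K) (μ : Fin N → ℝ) (ε : ℕ → Ω → Fin N → ℝ) (t : ℕ)
    (ω : Ω) : Stats N :=
  a.stats (fun s i => μ i + ε s ω i) t

theorem measurable_noisyStats (h₁ : IsAllocationOracle M r a.O₁) (h₂ : IsPairOracle M r a.O₂)
    (hi : ∀ t, a.init t ∈ M) (μ : Fin N → ℝ) {m : MeasurableSpace Ω} {t : ℕ}
    (hε : ∀ s ≤ t, Measurable (ε s)) :
    (∀ i, Measurable fun ω => (a.noisyStats μ ε t ω).count i) ∧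
      ∀ i, Measurable fun ω => (a.noisyStats μ ε t ω).total i :=
  measurable_stats (X := fun s ω i => μ i + ε s ω i) h₁ h₂ hi fun s hs =>
    measurable_pi_lambda _ fun i => ((measurable_pi_apply i).comp (hε s hs)).const_add _

/-- The exponential process of the noise collected for item `i`. -/
noncomputable def Algorithm.expNoise (a : Algorithm N K) (μ : Fin N → ℝ) (ε : ℕ → Ω → Fin N → ℝ) (σ l : ℝ)
    (i : Fin N) (t : ℕ) (ω : Ω) : ENNReal :=
  ENNReal.ofReal (Real.exp (l * ((a.noisyStats μ ε t ω).total i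
    - (a.noisyStats μ ε t ω).count i * μ i)
    - (a.noisyStats μ ε t ω).count i * (l ^ 2 * σ ^ 2 / 2)))

/-- A pull multiplies the process by a factor in the fresh noise, and no pull leaves it unchanged.
Writing this with indicators separates past from fresh noise. -/
theorem Algorithm.expNoise_succ (μ : Fin N → ℝ) (ε : ℕ → Ω → Fin N → ℝ) (σ l : ℝ)
    (i : Fin N) (t : ℕ) (ω : Ω) :
    a.expNoise μ ε σ l i (t + 1) ω =
      {ω | i ∈ a.pull (t + 1) (a.noisyStats μ ε t ω)}.indicator (a.expNoise μ ε σ l i t) ω *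
        ENNReal.ofReal (Real.exp (l * ε (t + 1) ω i - l ^ 2 * σ ^ 2 / 2)) +
      {ω | i ∈ a.pull (t + 1) (a.noisyStats μ ε t ω)}ᶜ.indicator (a.expNoise μ ε σ l i t) ω := by
  by_cases h : i ∈ a.pull (t + 1) (a.noisyStats μ ε t ω)
  · rw [Set.indicator_of_mem (by exact h), Set.indicator_of_notMem (by simpa using h), add_zero,
      expNoise, expNoise, ← ENNReal.ofReal_mul (Real.exp_nonneg _), ← Real.exp_add]
    unfold Algorithm.noisyStats at h ⊢
    rw [Algorithm.count_succ, Algorithm.total_succ, if_pos h, if_pos h]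
    congr 2
    push_cast
    ring
  · rw [Set.indicator_of_notMem (by exact h), Set.indicator_of_mem (by simpa using h), zero_mul,
      zero_add, expNoise, expNoise]
    unfold Algorithm.noisyStats at h ⊢
    rw [Algorithm.count_succ, Algorithm.total_succ, if_neg h, if_neg h]

theorem measurable_expNoise (h₁ : IsAllocationOracle M r a.O₁) (h₂ : IsPairOracle M r a.O₂)
    (hi : ∀ t, a.init t ∈ M) (μ : Fin N → ℝ) (l : ℝ) (i : Fin N) {m : MeasurableSpace Ω} {t : ℕ}
    (hε : ∀ s ≤ t, Measurable (ε s)) : Measurable (a.expNoise μ ε σ l i t) := by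
  obtain ⟨hc, ht⟩ := measurable_noisyStats h₁ h₂ hi μ hε
  have hc' : Measurable fun ω => ((a.noisyStats μ ε t ω).count i : ℝ) :=
    measurable_from_nat.comp (hc i)
  exact ((((ht i).sub (hc'.mul_const _)).const_mul l).sub (hc'.mul_const _)).exp.ennreal_ofReal

/-- The event that at round `t + 1` some mean lies outside its confidence interval. -/
def Algorithm.badEvent (a : Algorithm N K) (μ : Fin N → ℝ) (ε : ℕ → Ω → Fin N → ℝ) (t : ℕ) :
    Set Ω :=
  {ω | ¬ ∀ i, (a.noisyStats μ ε t ω).lcb a.α a.σ (t + 1) i ≤ μ i ∧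
    μ i ≤ (a.noisyStats μ ε t ω).ucb a.α a.σ (t + 1) i}

theorem measurableSet_badEvent (h₁ : IsAllocationOracle M r a.O₁) (h₂ : IsPairOracle M r a.O₂)
    (hi : ∀ t, a.init t ∈ M) (μ : Fin N → ℝ) {m : MeasurableSpace Ω} {t : ℕ} (hε : ∀ s ≤ t, Measurable (ε s)) :
    MeasurableSet (a.badEvent μ ε t) := by
  obtain ⟨hc, ht⟩ := measurable_noisyStats h₁ h₂ hi μ hε
  obtain ⟨hl, hu⟩ := measurable_bounds hc ht a.α a.σ (t + 1)
  refine (MeasurableSet.compl_iff (s := {ω | ∀ i, _})).2 ?_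
  rw [Set.ofPred_forall]
  exact MeasurableSet.iInter fun i =>
    (measurableSet_le ((measurable_pi_apply i).comp hl) measurable_const).inter
      (measurableSet_le measurable_const ((measurable_pi_apply i).comp hu))

variable [MeasurableSpace Ω] {P : Measure Ω}

theorem IsNoise.lintegral_exp_le [IsProbabilityMeasure P] (hε : IsNoise P σ ε) (l : ℝ) (t : ℕ)
    (i : Fin N) :
    ∫⁻ ω, ENNReal.ofReal (Real.exp (l * ε t ω i - l ^ 2 * σ ^ 2 / 2)) ∂P ≤ 1 := by
  have h := hε.subgaussian t i
  have h1 := h.mgf_le l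
  simp only [Real.exp_sub]
  rw [← ofReal_integral_eq_lintegral_ofReal ((h.integrable_exp_mul l).div_const _)
    (ae_of_all _ fun _ => by positivity), integral_div]
  refine ENNReal.ofReal_le_one.2 ((div_le_one (Real.exp_pos _)).2 (h1.trans ?_))
  rw [Real.coe_toNNReal _ (sq_nonneg σ), mul_comm]

/-- Whether `i` is pulled in round `t + 1` is decided by the past, which is independent of `ε (t +
1)`, and the fresh factor has mean at most `1`. Coordinates within a round may be dependent. -/
theorem lintegral_expNoise_le [IsProbabilityMeasure P] (h₁ : IsAllocationOracle M r a.O₁)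
    (h₂ : IsPairOracle M r a.O₂) (hi : ∀ t, a.init t ∈ M) (hε : IsNoise P σ ε) (μ : Fin N → ℝ)
    (l : ℝ) (i : Fin N) (t : ℕ) : ∫⁻ ω, a.expNoise μ ε σ l i t ω ∂P ≤ 1 := by
  induction t with
  | zero => simp [Algorithm.expNoise, Algorithm.noisyStats, Algorithm.stats]
  | succ t ih =>
    have hs : ∀ n, StronglyMeasurable (ε n) := fun n => (hε.measurable n).stronglyMeasurable
    have hm : ∀ s ≤ t, Measurable[Filtration.natural ε hs t] (ε s) := fun s hst =>
      (comap_measurable (ε s)).mono (le_iSup₂_of_le s hst le_rfl) le_rfl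
    obtain ⟨hc, ht⟩ := measurable_noisyStats h₁ h₂ hi μ hm
    have hp := measurableSet_mem_pull h₁ h₂ hi hc ht (t + 1) i
    have hE := measurable_expNoise (σ := σ) h₁ h₂ hi μ l i hm
    have hle := (Filtration.natural ε hs).le t
    have hg : Measurable[MeasurableSpace.comap (ε (t + 1)) MeasurableSpace.pi] fun ω =>
        ENNReal.ofReal (Real.exp (l * ε (t + 1) ω i - l ^ 2 * σ ^ 2 / 2)) :=
      (by fun_prop : Measurable fun x : Fin N → ℝ =>
        ENNReal.ofReal (Real.exp (l * x i - l ^ 2 * σ ^ 2 / 2))).comp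
        (comap_measurable (ε (t + 1)))
    have hind := (hε.indep.indep_comap_natural_of_lt hs (Nat.lt_succ_self t)).symm
    have hmul := lintegral_mul_eq_lintegral_mul_lintegral_of_independent_measurableSpace hle
      (hε.measurable (t + 1)).comap_le hind (hE.indicator hp) hg
    simp only [Algorithm.expNoise_succ]
    rw [lintegral_add_right _ ((hE.indicator hp.compl).mono hle le_rfl), hmul]
    calc _ ≤ (∫⁻ ω, {ω | i ∈ a.pull (t + 1) (a.noisyStats μ ε t ω)}.indicator
          (a.expNoise μ ε σ l i t) ω ∂P) * 1 + ∫⁻ ω, {ω | i ∈ a.pull (t + 1)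
          (a.noisyStats μ ε t ω)}ᶜ.indicator (a.expNoise μ ε σ l i t) ω ∂P := by
          gcongr
          exact hε.lintegral_exp_le l (t + 1) i
      _ = ∫⁻ ω, a.expNoise μ ε σ l i t ω ∂P := by
          rw [mul_one, lintegral_indicator (hle _ hp), lintegral_indicator (hle _ hp.compl),
            lintegral_add_compl _ (hle _ hp)]
      _ ≤ 1 := ih

/-- One-sided deviation, in the direction of the sign `e`, for a fixed number `k` of pulls. -/
theorem measure_deviation_le [IsProbabilityMeasure P] (h₁ : IsAllocationOracle M r a.O₁)
    (h₂ : IsPairOracle M r a.O₂) (hi : ∀ t, a.init t ∈ M) (hσ : 0 < σ) (hε : IsNoise P σ ε)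
    (μ : Fin N → ℝ) (i : Fin N) {α e : ℝ} (hα : 0 ≤ α) (he : e ^ 2 = 1) {n k : ℕ} (hn : 1 ≤ n)
    (hk : 1 ≤ k) (t : ℕ) :
    P {ω | (a.noisyStats μ ε t ω).count i = k ∧ (a.noisyStats μ ε t ω).radius α σ n i
      ≤ e * ((a.noisyStats μ ε t ω).mean i - μ i)} ≤ ENNReal.ofReal ((n : ℝ) ^ (-α)) := by
  have hn0 : (0 : ℝ) < n := by exact_mod_cast hn
  have hk0 : (0 : ℝ) < k := by exact_mod_cast hk
  have hlog : 0 ≤ Real.log ((n : ℝ) ^ α) := by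
    rw [Real.log_rpow hn0]
    exact mul_nonneg hα (Real.log_natCast_nonneg n)
  set ρ : ℝ := √(1 / (k : ℝ) * (2 * σ ^ 2 * Real.log ((n : ℝ) ^ α))) with hρ
  have hρ0 : 0 ≤ ρ := Real.sqrt_nonneg _
  have hρ2 : k * ρ ^ 2 = 2 * σ ^ 2 * Real.log ((n : ℝ) ^ α) := by
    rw [hρ, Real.sq_sqrt (by positivity)]
    field_simp
  have hpos : 0 < ENNReal.ofReal ((n : ℝ) ^ α) :=
    ENNReal.ofReal_pos.2 (Real.rpow_pos_of_pos hn0 α)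
  -- The Chernoff parameter `e * ρ / σ ^ 2` is optimal for `k` pulls: the exponent is at least `k *
  -- ρ ^ 2 / (2 * σ ^ 2)`, which equals `log (n ^ α)`.
  have hsub : {ω | (a.noisyStats μ ε t ω).count i = k ∧ (a.noisyStats μ ε t ω).radius α σ n i
      ≤ e * ((a.noisyStats μ ε t ω).mean i - μ i)} ⊆
      {ω | ENNReal.ofReal ((n : ℝ) ^ α) ≤ a.expNoise μ ε σ (e * ρ / σ ^ 2) i t ω} := by
    rintro ω ⟨hcount, hdev⟩
    simp only [Stats.radius, Stats.mean, hcount] at hdev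
    rw [← hρ] at hdev
    simp only [Set.mem_ofPred_eq, Algorithm.expNoise, hcount]
    apply ENNReal.ofReal_le_ofReal
    rw [← Real.exp_log (Real.rpow_pos_of_pos hn0 α)]
    apply Real.exp_le_exp.2
    set S := (a.noisyStats μ ε t ω).total i
    have hS : k * ρ ≤ e * (S - k * μ i) := by
      have := mul_le_mul_of_nonneg_left hdev hk0.le
      have h2 : (k : ℝ) * (e * (S / k - μ i)) = e * (S - k * μ i) := by field_simp
      linarith
    have h3 : Real.log ((n : ℝ) ^ α) = k * ρ ^ 2 / (2 * σ ^ 2) := by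
      rw [hρ2]; field_simp
    have h4 : e * ρ / σ ^ 2 * (S - k * μ i) = ρ / σ ^ 2 * (e * (S - k * μ i)) := by ring
    have h5 : (k : ℝ) * ((e * ρ / σ ^ 2) ^ 2 * σ ^ 2 / 2) = k * ρ ^ 2 / (2 * σ ^ 2) := by
      rw [div_pow, mul_pow, he]; field_simp
    have h6 : ρ / σ ^ 2 * (k * ρ) = 2 * (k * ρ ^ 2 / (2 * σ ^ 2)) := by field_simp
    have h7 := mul_le_mul_of_nonneg_left hS (div_nonneg hρ0 (sq_nonneg σ))
    rw [h3, h4, h5]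
    linarith
  refine (measure_mono hsub).trans ((meas_ge_le_lintegral_div (measurable_expNoise h₁ h₂ hi μ _ i
    fun s _ => hε.measurable s).aemeasurable hpos.ne' ENNReal.ofReal_ne_top).trans ?_)
  rw [Real.rpow_neg hn0.le, ENNReal.ofReal_inv_of_pos (Real.rpow_pos_of_pos hn0 α),
    ENNReal.div_eq_inv_mul]
  exact mul_le_of_le_one_right' (lintegral_expNoise_le h₁ h₂ hi hε μ _ i t)

/-- The Chernoff parameter depends on the number of pulls, which is random, so the union runs over
its values `1, …, t`, the items and both signs. The at most `n` values of the count turn the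
exponent `-α` into `1 - α`. -/
theorem measure_badEvent_le [IsProbabilityMeasure P] (h₁ : IsAllocationOracle M r a.O₁)
    (h₂ : IsPairOracle M r a.O₂) (hi : ∀ t, a.init t ∈ M) (hα : 0 ≤ a.α) (hσ : 0 < a.σ)
    (hε : IsNoise P a.σ ε) (μ : Fin N → ℝ) {t : ℕ} (hN : N ≤ t) :
    P.real (a.badEvent μ ε t) ≤ 2 * N * ((t + 1 : ℕ) : ℝ) ^ (1 - a.α) := by
  set n := t + 1 with hn
  set B : Fin N → ℕ → ℝ → Set Ω := fun i k e =>
    {ω | (a.noisyStats μ ε t ω).count i = k ∧ (a.noisyStats μ ε t ω).radius a.α a.σ n i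
      ≤ e * ((a.noisyStats μ ε t ω).mean i - μ i)} with hB
  have hn0 : (0 : ℝ) < n := by positivity
  have hBle : ∀ i, ∀ k ∈ Finset.Icc 1 t, ∀ e : ℝ, e ^ 2 = 1 → P.real (B i k e) ≤ (n : ℝ) ^ (-a.α) :=
    fun i k hk e he => ENNReal.toReal_le_of_le_ofReal (by positivity)
      (measure_deviation_le h₁ h₂ hi hσ hε μ i hα he (by omega) (Finset.mem_Icc.1 hk).1 t)
  have hsub : a.badEvent μ ε t ⊆ ⋃ i ∈ (Finset.univ : Finset (Fin N)), ⋃ k ∈ Finset.Icc 1 t,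
      (B i k 1 ∪ B i k (-1)) := by
    intro ω hω
    simp only [Algorithm.badEvent, Set.mem_ofPred_eq, not_forall] at hω
    obtain ⟨i, hω⟩ := hω
    simp only [Set.mem_iUnion]
    refine ⟨i, Finset.mem_univ _, (a.noisyStats μ ε t ω).count i, Finset.mem_Icc.2
      ⟨a.one_le_count _ (by omega), a.count_le _ _ _⟩, ?_⟩
    by_contra hcon
    simp only [hB, Set.mem_union, Set.mem_ofPred_eq, true_and, not_or, not_le] at hcon
    refine hω ⟨?_, ?_⟩
    · simp only [Stats.lcb]; linarith [hcon.1]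
    · simp only [Stats.ucb]; linarith [hcon.2]
  calc P.real (a.badEvent μ ε t)
      ≤ ∑ i : Fin N, ∑ k ∈ Finset.Icc 1 t, (P.real (B i k 1) + P.real (B i k (-1))) := by
        refine (measureReal_mono hsub (measure_ne_top _ _)).trans ((measureReal_biUnion_finset_le _ _).trans ?_)
        refine Finset.sum_le_sum fun i _ => (measureReal_biUnion_finset_le _ _).trans ?_
        exact Finset.sum_le_sum fun k _ => measureReal_union_le _ _
    _ ≤ ∑ i : Fin N, ∑ k ∈ Finset.Icc 1 t, ((n : ℝ) ^ (-a.α) + (n : ℝ) ^ (-a.α)) :=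
        Finset.sum_le_sum fun i _ => Finset.sum_le_sum fun k hk =>
          add_le_add (hBle i k hk 1 (by norm_num)) (hBle i k hk (-1) (by norm_num))
    _ = 2 * N * (t * (n : ℝ) ^ (-a.α)) := by
        simp only [Finset.sum_const, Finset.card_univ, Fintype.card_fin, Nat.card_Icc, nsmul_eq_mul,
          Nat.add_sub_cancel]
        ring
    _ ≤ 2 * N * (n : ℝ) ^ (1 - a.α) := by
        rw [sub_eq_add_neg, Real.rpow_add hn0, Real.rpow_one]
        have : (t : ℝ) ≤ n := by exact_mod_cast Nat.le_succ t
        gcongr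

end Concentration

/-! ### Regret bound -/

section Regret

variable {N K : ℕ} {r : Fin K → (Fin N → ℝ) → Finset (Fin N) → ℝ}
  {A : Fin K → Set (Finset (Fin N))} {M : Set (Assignment N K)} {a : Algorithm N K}
  {Ω : Type*} {ε : ℕ → Ω → Fin N → ℝ} {c D : ℝ}

/-- Shifting the rounds by one removes the subtraction `t - 1`: index `t` stands for round `t + 1`.
-/
theorem Algorithm.pathRegret_eq (a : Algorithm N K)
    (r : Fin K → (Fin N → ℝ) → Finset (Fin N) → ℝ) (μ : Fin N → ℝ) (ψ : Assignment N K)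
    (X : ℕ → Fin N → ℝ) (T : ℕ) :
    a.pathRegret r μ ψ X T =
      ∑ t ∈ Finset.range T, (envy r μ (a.choose (t + 1) (a.stats X t)) - envy r μ ψ) := by
  induction T with
  | zero => rfl
  | succ T ih =>
    rw [Finset.sum_range_succ, ← ih, Algorithm.pathRegret,
      Finset.sum_Icc_succ_top (Nat.le_add_left 1 T)]
    rfl

/-- The regret of a round after the initial ones, on the complement of the bad event. -/
theorem Algorithm.envy_choose_sub_le (hc : 0 ≤ c) (hr : LipschitzMonotone c A r)
    (hA : ∀ φ ∈ M, ∀ j, φ j ∈ ⋃ k, A k) (h₁ : IsAllocationOracle M r a.O₁)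
    (h₂ : IsPairOracle M r a.O₂) (hi : ∀ t, a.init t ∈ M) {μ : Fin N → ℝ} {ψ : Assignment N K}
    (hψ : ψ ∈ M) {t : ℕ} (ht : N ≤ t) {ω : Ω} (hω : ω ∉ a.badEvent μ ε t) :
    envy r μ (a.choose (t + 1) (a.noisyStats μ ε t ω)) - envy r μ ψ ≤
      4 * c * ∑ i ∈ a.pull (t + 1) (a.noisyStats μ ε t ω),
        (a.noisyStats μ ε t ω).radius a.α a.σ (t + 1) i := by
  set s := a.noisyStats μ ε t ω with hs
  have hω' : ∀ i, s.lcb a.α a.σ (t + 1) i ≤ μ i ∧ μ i ≤ s.ucb a.α a.σ (t + 1) i :=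
    not_not.1 hω
  have hN : ¬ t + 1 ≤ N := by omega
  have hφ := a.choose_mem h₁ hi (t + 1) s
  have hchoose : a.choose (t + 1) s = a.O₁ (s.lcb a.α a.σ (t + 1)) (s.ucb a.α a.σ (t + 1)) :=
    if_neg hN
  have hmin := (h₁.1 (s.lcb a.α a.σ (t + 1)) (s.ucb a.α a.σ (t + 1))).2 ψ hψ
  rw [← hchoose] at hmin
  have h := envy_sub_envy_le hc hr hA (fun i => (hω' i).1) (fun i => (hω' i).2) hφ hψ hmin
    (h₂.1 (s.ucb a.α a.σ (t + 1)) (s.lcb a.α a.σ (t + 1)) _ hφ)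
  refine h.trans (le_of_eq ?_)
  have hpull : a.pull (t + 1) s = a.choose (t + 1) s (a.O₂ (s.ucb a.α a.σ (t + 1))
      (s.lcb a.α a.σ (t + 1)) (a.choose (t + 1) s)).1 ∪ a.choose (t + 1) s
      (a.O₂ (s.ucb a.α a.σ (t + 1)) (s.lcb a.α a.σ (t + 1)) (a.choose (t + 1) s)).2 :=
    if_neg hN
  rw [hpull, Finset.mul_sum, Finset.mul_sum]
  refine Finset.sum_congr rfl fun i _ => ?_
  have h0 : 0 ≤ s.radius a.α a.σ (t + 1) i := Real.sqrt_nonneg _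
  -- An interval is two radii wide, which turns `2 * c` into `4 * c`.
  have h1 : s.ucb a.α a.σ (t + 1) i - s.lcb a.α a.σ (t + 1) i
      = 2 * s.radius a.α a.σ (t + 1) i := by
    simp only [Stats.ucb, Stats.lcb]; ring
  rw [h1, abs_of_nonneg (by positivity)]
  ring

/-- Pathwise regret bound: initial rounds, bad rounds, and the sum of the confidence radii. -/
theorem Algorithm.pathRegret_le (hc : 0 ≤ c) (hr : LipschitzMonotone c A r)
    (hA : ∀ φ ∈ M, ∀ j, φ j ∈ ⋃ k, A k) (h₁ : IsAllocationOracle M r a.O₁)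
    (h₂ : IsPairOracle M r a.O₂) (hi : ∀ t, a.init t ∈ M) (hα : 0 ≤ a.α) {μ : Fin N → ℝ}
    (hD : 0 ≤ D) (hB : BoundedEnvyRange D M r μ) {ψ : Assignment N K} (hψ : ψ ∈ M) {T : ℕ}
    (hT : N ≤ T) (ω : Ω) :
    a.pathRegret r μ ψ (fun t i => μ i + ε t ω i) T ≤
      N * D + ∑ t ∈ Finset.Ico N T, (a.badEvent μ ε t).indicator (fun _ => D) ω +
        4 * c * (N * (√(2 * a.σ ^ 2 * a.α * Real.log T) * (3 * √T))) := by
  have hrange : ∀ t, envy r μ (a.choose (t + 1) (a.noisyStats μ ε t ω)) - envy r μ ψ ≤ D :=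
    fun t => envy_sub_envy_le_range hD hB (a.choose_mem h₁ hi _ _) hψ
  have hrad : ∀ t, 0 ≤ 4 * c * ∑ i ∈ a.pull (t + 1) (a.noisyStats μ ε t ω),
      (a.noisyStats μ ε t ω).radius a.α a.σ (t + 1) i := fun t =>
    mul_nonneg (by positivity) (Finset.sum_nonneg fun _ _ => Real.sqrt_nonneg _)
  rw [a.pathRegret_eq, ← Finset.sum_range_add_sum_Ico _ hT, add_assoc]
  refine add_le_add ?_ ?_
  · refine (Finset.sum_le_sum fun t _ => hrange t).trans (le_of_eq ?_)
    simp
  · have hsum := mul_le_mul_of_nonneg_left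
      (a.sum_radius_le hα (fun t i => μ i + ε t ω i) hT) (by positivity : 0 ≤ 4 * c)
    -- With the radii back in place of their bound, rounds can be compared one by one.
    refine le_trans ?_ (add_le_add_right hsum _)
    rw [Finset.mul_sum, ← Finset.sum_add_distrib]
    refine Finset.sum_le_sum fun t ht => ?_
    by_cases hω : ω ∈ a.badEvent μ ε t
    · rw [Set.indicator_of_mem hω]
      exact (hrange t).trans (le_add_of_nonneg_right (hrad t))
    · rw [Set.indicator_of_notMem hω, zero_add]
      exact a.envy_choose_sub_le hc hr hA h₁ h₂ hi hψ (Finset.mem_Ico.1 ht).1 hω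

variable [MeasurableSpace Ω] {P : Measure Ω} [IsProbabilityMeasure P]

/-- There are finitely many assignments, so the regret of each round is a bounded function of a
discrete random variable. -/
theorem Algorithm.integrable_pathRegret (h₁ : IsAllocationOracle M r a.O₁)
    (h₂ : IsPairOracle M r a.O₂) (hi : ∀ t, a.init t ∈ M) (hε : ∀ t, Measurable (ε t))
    (μ : Fin N → ℝ) (ψ : Assignment N K) (T : ℕ) :
    Integrable (fun ω => a.pathRegret r μ ψ (fun t i => μ i + ε t ω i) T) P := by
  simp only [Algorithm.pathRegret_eq]
  refine integrable_finsetSum _ fun t _ => ?_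
  obtain ⟨hc, ht⟩ := measurable_noisyStats h₁ h₂ hi μ (t := t) fun s _ => hε s
  let _ : MeasurableSpace (Assignment N K) := ⊤
  have hm : Measurable fun ω => a.choose (t + 1) (a.noisyStats μ ε t ω) :=
    measurable_to_countable' fun φ => measurableSet_choose_eq h₁ hc ht (t + 1) φ
  have hf : Measurable fun φ : Assignment N K => envy r μ φ - envy r μ ψ := measurable_from_top
  obtain ⟨b, hb⟩ := (Set.finite_range fun φ : Assignment N K =>
    ‖envy r μ φ - envy r μ ψ‖).bddAbove
  exact Integrable.of_bound (hf.comp hm).aestronglyMeasurable b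
    (ae_of_all _ fun ω => hb ⟨_, rfl⟩)

/-- Only the bad-event terms of the pathwise bound are random. Their probabilities are bounded by a
full convergent series, so the constant is free of `N` and `T`. -/
theorem Algorithm.integral_pathRegret_le (hc : 0 ≤ c) (hr : LipschitzMonotone c A r)
    (hA : ∀ φ ∈ M, ∀ j, φ j ∈ ⋃ k, A k) (h₁ : IsAllocationOracle M r a.O₁)
    (h₂ : IsPairOracle M r a.O₂) (hi : ∀ t, a.init t ∈ M) (hα : 2 < a.α) (hσ : 0 < a.σ)
    (hε : IsNoise P a.σ ε) {μ : Fin N → ℝ} (hD : 0 ≤ D) (hB : BoundedEnvyRange D M r μ)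
    {ψ : Assignment N K} (hψ : ψ ∈ M) {T : ℕ} (hT : N ≤ T) :
    ∫ ω, a.pathRegret r μ ψ (fun t i => μ i + ε t ω i) T ∂P ≤
      N * ((D + 2 * D * ∑' n : ℕ, (n : ℝ) ^ (1 - a.α)) +
        12 * c * √(2 * a.σ ^ 2 * a.α) * (√(Real.log T) * √T)) := by
  have hmeas : ∀ t, MeasurableSet (a.badEvent μ ε t) := fun t =>
    measurableSet_badEvent h₁ h₂ hi μ fun s _ => hε.measurable s
  have hint : ∀ t ∈ Finset.Ico N T,
      Integrable ((a.badEvent μ ε t).indicator (fun _ => D)) P := fun t _ =>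
    (integrable_const D).indicator (hmeas t)
  have hsum := integrable_finsetSum _ hint
  have hsum' : Integrable (fun ω => N * D + ∑ t ∈ Finset.Ico N T,
      (a.badEvent μ ε t).indicator (fun _ => D) ω) P := (integrable_const _).add hsum
  have hsummable : Summable fun n : ℕ => (n : ℝ) ^ (1 - a.α) :=
    Real.summable_nat_rpow.2 (by linarith)
  have hbad : ∑ t ∈ Finset.Ico N T, P.real (a.badEvent μ ε t) * D ≤
      N * (2 * D * ∑' n : ℕ, (n : ℝ) ^ (1 - a.α)) := by
    calc _ ≤ ∑ t ∈ Finset.Ico N T, 2 * N * ((t + 1 : ℕ) : ℝ) ^ (1 - a.α) * D :=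
          Finset.sum_le_sum fun t ht => mul_le_mul_of_nonneg_right
            (measure_badEvent_le h₁ h₂ hi (by linarith) hσ hε μ (Finset.mem_Ico.1 ht).1) hD
      _ = N * (2 * D * ∑ t ∈ Finset.Ico (N + 1) (T + 1), (t : ℝ) ^ (1 - a.α)) := by
          rw [← Finset.sum_Ico_add' (fun t : ℕ => (t : ℝ) ^ (1 - a.α)), Finset.mul_sum,
            Finset.mul_sum]
          exact Finset.sum_congr rfl fun t _ => by ring
      _ ≤ _ := by
          have := hsummable.sum_le_tsum (Finset.Ico (N + 1) (T + 1)) fun n _ => by positivity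
          gcongr
  calc _ ≤ ∫ ω, (N * D + ∑ t ∈ Finset.Ico N T, (a.badEvent μ ε t).indicator (fun _ => D) ω +
        4 * c * (N * (√(2 * a.σ ^ 2 * a.α * Real.log T) * (3 * √T)))) ∂P :=
        integral_mono (a.integrable_pathRegret h₁ h₂ hi hε.measurable μ ψ T)
          (hsum'.add (integrable_const _)) fun ω =>
          a.pathRegret_le hc hr hA h₁ h₂ hi (by linarith) hD hB hψ hT ω
    _ = N * D + ∑ t ∈ Finset.Ico N T, P.real (a.badEvent μ ε t) * D +
        4 * c * (N * (√(2 * a.σ ^ 2 * a.α * Real.log T) * (3 * √T))) := by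
        rw [integral_add hsum' (integrable_const _),
          integral_add (integrable_const _) hsum, integral_finsetSum _ hint]
        simp [integral_indicator_const, hmeas]
    _ ≤ _ := by
        rw [Real.sqrt_mul (by positivity)]
        linarith

end Regret

end EnvyBandit

/-! ### The proposition -/

theorem mainTheorem9 (α σ c D : ℝ) (hα : 2 < α) (hσ : 0 < σ) (hc : 0 < c) (hD : 0 < D) :
    ∃ C : ℝ, 0 < C ∧
      ∀ (N K T : ℕ), N < T →
      ∀ (A : Fin K → Set (Finset (Fin N))), (∀ j, ∅ ∈ A j) →
      ∀ (M : Set (EnvyBandit.Assignment N K)),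
        (M = EnvyBandit.disjointAllocations A ∨ M = EnvyBandit.distinctAllocations A) →
      ∀ (r : Fin K → (Fin N → ℝ) → Finset (Fin N) → ℝ), EnvyBandit.LipschitzMonotone c A r →
      ∀ (μ : Fin N → ℝ), EnvyBandit.BoundedEnvyRange D M r μ →
      ∀ (a : EnvyBandit.Algorithm N K), a.α = α → a.σ = σ →
        EnvyBandit.IsAllocationOracle M r a.O₁ → EnvyBandit.IsPairOracle M r a.O₂ →
        (∀ t, a.init t ∈ M) →
      ∀ (φstar : EnvyBandit.Assignment N K), φstar ∈ EnvyBandit.minEnvySet M r μ →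
      ∀ (Ω : Type*) [MeasurableSpace Ω] (P : MeasureTheory.Measure Ω)
        [MeasureTheory.IsProbabilityMeasure P] (ε : ℕ → Ω → Fin N → ℝ),
        EnvyBandit.IsNoise P σ ε →
        MeasureTheory.Integrable
            (fun ω => a.pathRegret r μ φstar (fun t i => μ i + ε t ω i) T) P ∧
          ∫ ω, a.pathRegret r μ φstar (fun t i => μ i + ε t ω i) T ∂P
            ≤ C * ((N : ℝ) * (T : ℝ) ^ ((2 : ℝ) / 3) * Real.log (T : ℝ) ^ ((1 : ℝ) / 2)) := by
  set B : ℝ := D + 2 * D * ∑' n : ℕ, (n : ℝ) ^ (1 - α) with hB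
  set E : ℝ := 12 * c * √(2 * σ ^ 2 * α) with hE
  have hB0 : 0 < B := by
    have : 0 ≤ ∑' n : ℕ, (n : ℝ) ^ (1 - α) := tsum_nonneg fun n => by positivity
    positivity
  have hE0 : 0 < E := by positivity
  have hlog2 : 0 < √(Real.log 2) := Real.sqrt_pos.2 (Real.log_pos one_lt_two)
  -- The term `B` has no logarithm; dividing by `√(log 2)` lets `√(log T)` absorb it once `T ≥ 2`.
  refine ⟨B / √(Real.log 2) + E, by positivity, ?_⟩
  intro N K T hT A _ M hM r hr μ hrange a hα' hσ' h₁ h₂ hi ψ hψ Ω _ P _ ε hε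
  subst hα' hσ'
  refine ⟨a.integrable_pathRegret h₁ h₂ hi hε.measurable μ ψ T, ?_⟩
  refine (a.integral_pathRegret_le hc.le hr
    (fun φ hφ => EnvyBandit.mem_iUnion_of_mem_allocations hM hφ) h₁ h₂ hi hα hσ hε hD.le hrange
    hψ.1 hT.le).trans ?_
  rw [← hB, ← hE, mul_assoc (N : ℝ), mul_left_comm (B / _ + E) (N : ℝ), ← Real.sqrt_eq_rpow]
  -- For `N = 0` the value `T = 1` is possible, but both sides vanish; otherwise `T ≥ 2`.
  rcases Nat.eq_zero_or_pos N with rfl | hN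
  · simp
  refine mul_le_mul_of_nonneg_left ?_ (Nat.cast_nonneg N)
  have hT2 : (2 : ℝ) ≤ T := by exact_mod_cast (by omega : 2 ≤ T)
  have hlog : √(Real.log 2) ≤ √(Real.log T) :=
    Real.sqrt_le_sqrt (Real.log_le_log two_pos hT2)
  have hT1 : 1 ≤ (T : ℝ) ^ ((2 : ℝ) / 3) := Real.one_le_rpow (by linarith) (by norm_num)
  have hTs : √(T : ℝ) ≤ (T : ℝ) ^ ((2 : ℝ) / 3) := by
    rw [Real.sqrt_eq_rpow]
    exact Real.rpow_le_rpow_of_exponent_le (by linarith) (by norm_num)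
  have h1 : B ≤ B / √(Real.log 2) * ((T : ℝ) ^ ((2 : ℝ) / 3) * √(Real.log T)) := by
    calc B = B / √(Real.log 2) * (1 * √(Real.log 2)) := by field_simp
      _ ≤ _ := by gcongr
  have h2 : E * (√(Real.log T) * √T) ≤ E * ((T : ℝ) ^ ((2 : ℝ) / 3) * √(Real.log T)) := by
    rw [mul_comm (√(Real.log T))]
    gcongr
  rw [add_mul]
  exact add_le_add h1 h2
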